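/- Let $n\ge 1$, let $f$ be a norm on $\mathbb{R}^n$ and let $\mathbf{x}\in\mathbb{R}^n$ with $\|\mathbf{x}\|_2=1$. Let $\mathbf{g}\sim\mathcal{N}(0,\mathbf{I}_n)$ and put $\mathbf{Q}_{\mathbf{x}}=\mathbf{I}_n+\big(\sqrt{\pi/2}-1\big)\mathbf{x}\mathbf{x}^\top$, an invertible matrix. Let $\mathcal{T}_f(\mathbf{x})=\{\mathbf{u}\in\mathbb{R}^n:\exists t>0,\ f(\mathbf{x}+t\mathbf{u})\le f(\mathbf{x})\}$ be the descent cone and $\partial f(\mathbf{x})=\{\mathbf{u}\in\mathbb{R}^n: f(\mathbf{y})\ge f(\mathbf{x})+\langle\mathbf{u},\mathbf{y}-\mathbf{x}\rangle\ \forall\,\mathbf{y}\in\mathbb{R}^n\}$ the subdifferential of $f$ at $\mathbf{x}$. For $\mathcal{W}\subset\mathbb{R}^n$ write $\mathrm{rad}(\mathcal{W})=\sup_{\mathbf{w}\in\mathcal{W}}\|\mathbf{w}\|_2$ and $\mathrm{dist}(\mathbf{a},\mathcal{W})=\inf_{\mathbf{w}\in\mathcal{W}}\|\mathbf{a}-\mathbf{w}\|_2$.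 Define $$\zeta_{PO}(\mathbf{x};f)=\Big[\mathbb{E}\sup_{\mathbf{u}\in\mathcal{T}_f(\mathbf{x}),\ \|\mathbf{Q}_{\mathbf{x}}\mathbf{u}\|_2=1}\big\langle(\mathbf{I}_n-\mathbf{x}\mathbf{x}^\top)\mathbf{g},\mathbf{u}\big\rangle\Big]^2,\qquad \hat\zeta_{PO}(\mathbf{x};f)=\inf_{\tau\ge0}\mathbb{E}\big[\mathrm{dist}^2(\mathbf{g},\tau\,\mathbf{Q}_{\mathbf{x}}^{-1}\partial f(\mathbf{x}))\big].$$ Then the sets over which the supremum in $\zeta_{PO}$ and the radius of $\mathbf{Q}_{\mathbf{x}}^{-1}\partial f(\mathbf{x})$ are taken are non-empty and bounded, all expectations above are finite, and $$\hat\zeta_{PO}(\mathbf{x};f)-\sqrt{\frac{8\,\hat\zeta_{PO}(\mathbf{x};f)}{\pi}}-\frac{\sqrt{2\pi}\,\mathrm{rad}\big(\mathbf{Q}_{\mathbf{x}}^{-1}\partial f(\mathbf{x})\big)}{f(\mathbf{x})}-\Big(1-\frac2\pi\Big)\le\zeta_{PO}(\mathbf{x};f)\le\hat\zeta_{PO}(\mathbf{x};f).$$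 -/

import Mathlib

open scoped Pointwise NNReal RealInnerProductSpace

namespace PhaseOnly

noncomputable section

/-- `ℝⁿ` with the Euclidean norm and inner product. -/
abbrev Vec (n : ℕ) : Type := EuclideanSpace ℝ (Fin n)

/-- The descent cone of `f` at `w`. -/
def descentCone {n : ℕ} (f : Vec n → ℝ) (w : Vec n) : Set (Vec n) :=
  {u | ∃ t : ℝ, 0 < t ∧ f (w + t • u) ≤ f w}

/-- The subdifferential of `f` at `w`. -/
def subdiff {n : ℕ} (f : Vec n → ℝ) (w : Vec n) : Set (Vec n) :=
  {u | ∀ y : Vec n, f w + ⟪u, y - w⟫ ≤ f y}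

/-- The radius of a set, the supremum of the Euclidean norms of its elements. -/
def rad {n : ℕ} (W : Set (Vec n)) : ℝ :=
  sSup ((fun w => ‖w‖) '' W)

/-- The linear map `Q_x = I + (√(π/2) - 1) x xᵀ`. -/
def Q {n : ℕ} (x : Vec n) : Vec n →L[ℝ] Vec n :=
  ContinuousLinearMap.id ℝ (Vec n) +
    (√(Real.pi / 2) - 1) • (innerSL ℝ x).smulRight x

lemma Q_apply {n : ℕ} (x u : Vec n) :
    Q x u = u + (√(Real.pi / 2) - 1) • ⟪x, u⟫ • x := by
  simp [Q]

/-- The inverse of `Q_x` as a linear map. For a unit vector `x` the map `Q_x` is invertible, see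
`Q_isInvertible` and `QInv_apply`. -/
def QInv {n : ℕ} (x : Vec n) : Vec n →L[ℝ] Vec n :=
  (Q x).inverse

lemma sqrt_aux : √(Real.pi / 2) * √(2 / Real.pi) = 1 := by
  rw [← Real.sqrt_mul (by positivity)]
  have : Real.pi / 2 * (2 / Real.pi) = 1 := by field_simp
  rw [this, Real.sqrt_one]

lemma Q_comp_aux {n : ℕ} {x : Vec n} (hx : ‖x‖ = 1) (a b : ℝ) (hab : a * b = 1) :
    (ContinuousLinearMap.id ℝ (Vec n) + (a - 1) • (innerSL ℝ x).smulRight x).comp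
      (ContinuousLinearMap.id ℝ (Vec n) + (b - 1) • (innerSL ℝ x).smulRight x) =
      ContinuousLinearMap.id ℝ (Vec n) := by
  ext1 u
  have hxx : ⟪x, x⟫ = 1 := by rw [real_inner_self_eq_norm_sq, hx]; norm_num
  simp only [ContinuousLinearMap.comp_apply, add_apply,
    ContinuousLinearMap.id_apply, smul_apply,
    ContinuousLinearMap.smulRight_apply, innerSL_apply_apply, inner_add_right,
    inner_smul_right, hxx]
  have : (b - 1) * ⟪x, u⟫ + (a - 1) * (⟪x, u⟫ + (b - 1) * (⟪x, u⟫ * 1)) = 0 := by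
    linear_combination ⟪x, u⟫ * hab
  rw [add_assoc, smul_smul, smul_smul, ← add_smul, this, zero_smul, add_zero]

lemma Q_isInvertible {n : ℕ} {x : Vec n} (hx : ‖x‖ = 1) : (Q x).IsInvertible :=
  ContinuousLinearMap.IsInvertible.of_inverse
    (Q_comp_aux hx _ _ sqrt_aux) (Q_comp_aux hx _ _ ((mul_comm _ _).trans sqrt_aux))

lemma QInv_apply {n : ℕ} {x : Vec n} (hx : ‖x‖ = 1) (u : Vec n) :
    QInv x u = u - (1 - √(2 / Real.pi)) • ⟪x, u⟫ • x := by
  have h := ContinuousLinearMap.inverse_eq (Q_comp_aux hx _ _ sqrt_aux)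
    (Q_comp_aux hx _ _ ((mul_comm _ _).trans sqrt_aux))
  change (Q x).inverse = _ at h
  rw [QInv, h]
  simp only [add_apply, ContinuousLinearMap.id_apply,
    smul_apply, ContinuousLinearMap.smulRight_apply, innerSL_apply_apply]
  rw [sub_eq_add_neg u, ← neg_smul, neg_sub]

/-- The law `N(0, Iₙ)` of the standard Gaussian vector `g` in `ℝⁿ`. -/
abbrev gaussianLaw (n : ℕ) : MeasureTheory.Measure (Vec n) :=
  ProbabilityTheory.stdGaussian (Vec n)

/-- The index set of the supremum in `zetaPO`: all `u` in the descent cone of `f` at `x` with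
`‖Q_x u‖₂ = 1`. -/
def constraintSet {n : ℕ} (f : Vec n → ℝ) (x : Vec n) : Set (Vec n) :=
  {u | u ∈ descentCone f x ∧ ‖Q x u‖ = 1}

/-- The supremum of `⟨(I - x xᵀ) g, u⟩` over the constraint set, as a function of `g`. -/
def widthFun {n : ℕ} (f : Vec n → ℝ) (x g : Vec n) : ℝ :=
  sSup ((fun u => ⟪g - ⟪x, g⟫ • x, u⟫) '' constraintSet f x)

/-- `ζ_PO(x; f)`, the square of the expected supremum. -/
def zetaPO {n : ℕ} (f : Vec n → ℝ) (x : Vec n) : ℝ :=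
  (∫ g, widthFun f x g ∂(gaussianLaw n)) ^ 2

/-- The set `Q_x⁻¹ ∂f(x)`. -/
def scaledSubdiff {n : ℕ} (f : Vec n → ℝ) (x : Vec n) : Set (Vec n) :=
  QInv x '' subdiff f x

/-- The surrogate `inf_{τ ≥ 0} E dist²(g, τ Q_x⁻¹ ∂f(x))`. -/
def zetaHat {n : ℕ} (f : Vec n → ℝ) (x : Vec n) : ℝ :=
  ⨅ τ : ℝ≥0, ∫ g, Metric.infDist g ((τ : ℝ) • scaledSubdiff f x) ^ 2 ∂(gaussianLaw n)

end

end PhaseOnly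

/-!
Write `S = Q⁻¹ ∂f(x)`, let `C` be the image of the descent cone under `Q`, and let `K` be the cone
generated by `S`. By Hahn-Banach, the closure of `C` is the polar cone of `K`. As `(I - x xᵀ) g` is
orthogonal to `x`, the width of the constraint set is `sup ⟪(I - x xᵀ) g, v⟫` over the unit vectors
`v` of `C`. Since `-x` points into `C`, this width is nonnegative.

*Upper bound.* The vector `(I - x xᵀ) g` is the average of `g` and of its reflection across the
hyperplane orthogonal to `x`, which has the same law. For each of the two, the supremum over the
unit vectors of `C` is at most the distance to `τ S`, by polarity. So the expected width is at most
`𝔼 dist(g, τ S)` for every `τ ≥ 0`, and `(𝔼 dist)² ≤ 𝔼 dist²`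
(`widthFun_le_average_infDist`, `zetaPO_le_integral`).

*Lower bound.* Let `c = √(2/π) = 𝔼 |⟪x, g⟫|`. Three estimates are combined:
* `dist(g, K)` is at most the width plus `|⟪x, g⟫|`, by Moreau's decomposition of `g` with respect
  to `K` and its polar cone (`infDist_coneOver_le`), whence
  `𝔼 dist(g, K) ≤ 𝔼 widthFun + c`;
* `𝔼 dist²(g, K) ≤ (𝔼 dist(g, K))² + 1`, by the Gaussian Poincaré inequality, because the distance
  is `1`-Lipschitz;
* `inf_τ 𝔼 dist²(g, τ S) ≤ 𝔼 dist²(g, K) + 2 rad S / (c f(x))`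
  (`exists_integral_infDist_smul_sq_le`). Here `S` lies in the hyperplane `⟪s, x⟫ = c f(x)`, so the
  best dilation factor for a given `g` is a linear function of the projection of `g` onto `K`, hence
  Lipschitz. The dilation factor is fixed at the mean of the random optimal one, and the excess is
  a covariance of two Lipschitz functions, bounded by the Poincaré inequality once more.

The Poincaré inequality `Var h(g) ≤ L²` for an `L`-Lipschitz function `h`
(`LipschitzWith.variance_stdGaussian_le`) is proved by splitting `g` into many small independent
Gaussian steps. By the law of total variance, the variance is the sum of the contributions of the
steps; for a function with Lipschitz derivative, a step of variance `s²` contributes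
`s² L² + O(s³)`, uniformly, as the class is stable under averaging of translates. General Lipschitz
functions are approximated by mollification.
-/

open MeasureTheory ProbabilityTheory Filter Topology

section GaussianPoincare

variable {E : Type*} [NormedAddCommGroup E] [InnerProductSpace ℝ E]

/-! ### Lipschitz functions of a standard Gaussian vector -/

lemma LipschitzWith.comp_add_smul {K : ℝ≥0} {h : E → ℝ} (hh : LipschitzWith K h) (z : E) (s : ℝ) :
    LipschitzWith (K * ‖s‖₊) (fun y => h (z + s • y)) := by
  refine hh.comp (LipschitzWith.of_dist_le_mul fun y y' => ?_)
  rw [dist_add_left, dist_smul₀, coe_nnnorm]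

variable [FiniteDimensional ℝ E] [MeasurableSpace E] [BorelSpace E]

lemma LipschitzWith.memLp_two_stdGaussian {K : ℝ≥0} {h : E → ℝ} (hh : LipschitzWith K h) :
    MemLp h 2 (stdGaussian E) := by
  refine ((memLp_const ‖h 0‖).add
    ((IsGaussian.memLp_two_id (μ := stdGaussian E)).norm.const_mul (K : ℝ))).mono'
    hh.continuous.aestronglyMeasurable (Eventually.of_forall fun y => ?_)
  have h1 := hh.dist_le_mul y 0
  rw [dist_eq_norm, dist_zero_right] at h1
  calc ‖h y‖ = ‖h 0 + (h y - h 0)‖ := by congr 1; ring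
    _ ≤ ‖h 0‖ + ‖h y - h 0‖ := norm_add_le _ _
    _ ≤ ‖h 0‖ + K * ‖y‖ := by gcongr

lemma LipschitzWith.integrable_stdGaussian {K : ℝ≥0} {h : E → ℝ} (hh : LipschitzWith K h) :
    Integrable h (stdGaussian E) :=
  hh.memLp_two_stdGaussian.integrable one_le_two

lemma variance_le_integral_sub_sq {Ω : Type*} {mΩ : MeasurableSpace Ω} {μ : Measure Ω}
    [IsProbabilityMeasure μ] {X : Ω → ℝ} (hX : MemLp X 2 μ) (c : ℝ) :
    Var[X; μ] ≤ ∫ ω, (X ω - c) ^ 2 ∂μ := by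
  rw [← variance_sub_const hX.aestronglyMeasurable c]
  exact variance_le_expectation_sq (hX.aestronglyMeasurable.sub aestronglyMeasurable_const)

/-- For independent standard Gaussian vectors `X, Y`, the vector `a X + b Y` has the law of
`√(a² + b²) X`. -/
lemma stdGaussian_prod_map_add_smul {a b c : ℝ} (h : a ^ 2 + b ^ 2 = c ^ 2) :
    ((stdGaussian E).prod (stdGaussian E)).map (fun p => a • p.1 + b • p.2) =
      (stdGaussian E).map (fun w => c • w) := by
  have h1 : ((stdGaussian E).prod (stdGaussian E)).map (fun p => a • p.1 + b • p.2) =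
      ((stdGaussian E).map (a • ·)) ∗ ((stdGaussian E).map (b • ·)) := by
    rw [Measure.conv, Measure.map_prod_map _ _ (by fun_prop) (by fun_prop),
      Measure.map_map (by fun_prop) (by fun_prop)]
    rfl
  rw [h1]
  apply Measure.ext_of_charFun
  ext t
  rw [charFun_conv, charFun_map_smul, charFun_map_smul, charFun_map_smul, charFun_stdGaussian,
    charFun_stdGaussian, charFun_stdGaussian, ← Complex.exp_add]
  congr 1
  simp only [norm_smul, mul_pow, Real.norm_eq_abs, Complex.ofReal_mul]
  have : (c : ℂ) ^ 2 = a ^ 2 + b ^ 2 := by exact_mod_cast h.symm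
  simp only [← Complex.ofReal_pow, sq_abs]
  simp only [Complex.ofReal_pow, this]
  ring

/-- The smoothing of `f` at scale `s`: the average of `f` under the law of `z + s X`, where `X` is
a standard Gaussian vector. -/
noncomputable def gaussianSmooth {F : Type*} [NormedAddCommGroup F] [NormedSpace ℝ F]
    (s : ℝ) (f : E → F) (z : E) : F :=
  ∫ y, f (z + s • y) ∂(stdGaussian E)

lemma LipschitzWith.gaussianSmooth {K : ℝ≥0} {f : E → ℝ} (hf : LipschitzWith K f) (s : ℝ) :
    LipschitzWith K (gaussianSmooth s f) := by
  refine LipschitzWith.of_dist_le_mul fun z z' => ?_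
  rw [_root_.gaussianSmooth, _root_.gaussianSmooth, dist_eq_norm,
    ← integral_sub (hf.comp_add_smul z s).integrable_stdGaussian
      (hf.comp_add_smul z' s).integrable_stdGaussian]
  refine (norm_integral_le_of_norm_le_const (C := K * dist z z')
    (Eventually.of_forall fun y => ?_)).trans (by simp)
  rw [← dist_eq_norm]
  simpa using hf.dist_le_mul (z + s • y) (z' + s • y)

/-- The law of total variance for `f (z + a X + b Y)`, conditionally on `X`. -/
lemma variance_eq_integral_variance_add {K : ℝ≥0} {f : E → ℝ} (hf : LipschitzWith K f)
    {a b c : ℝ} (h : a ^ 2 + b ^ 2 = c ^ 2) (z : E) :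
    Var[fun y => f (z + c • y); stdGaussian E] =
      ∫ x, Var[fun y => f (z + a • x + b • y); stdGaussian E] ∂(stdGaussian E) +
      Var[fun x => gaussianSmooth b f (z + a • x); stdGaussian E] := by
  have key : ∀ F : E → ℝ, Continuous F → Integrable (fun w => F (c • w)) (stdGaussian E) →
      Integrable (fun p : E × E => F (a • p.1 + b • p.2)) ((stdGaussian E).prod (stdGaussian E)) ∧
      ∫ w, F (c • w) ∂(stdGaussian E) =
        ∫ x, ∫ y, F (a • x + b • y) ∂(stdGaussian E) ∂(stdGaussian E) := by
    intro F hF hi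
    have hm := stdGaussian_prod_map_add_smul (E := E) h
    have h1 : Integrable (fun p : E × E => F (a • p.1 + b • p.2))
        ((stdGaussian E).prod (stdGaussian E)) := by
      refine (integrable_map_measure (f := fun p : E × E => a • p.1 + b • p.2)
        hF.aestronglyMeasurable (by fun_prop)).mp ?_
      rw [hm, integrable_map_measure hF.aestronglyMeasurable (by fun_prop)]
      exact hi
    refine ⟨h1, ?_⟩
    rw [← integral_prod _ h1, ← integral_map (φ := fun w : E => c • w) (by fun_prop)
      hF.aestronglyMeasurable, ← hm, integral_map (by fun_prop) hF.aestronglyMeasurable]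
  have hcf := hf.continuous
  have hL := (hf.comp_add_smul z c)
  obtain ⟨-, e1⟩ := key (fun w => f (z + w)) (by fun_prop) hL.integrable_stdGaussian
  obtain ⟨i2, e2⟩ := key (fun w => f (z + w) ^ 2) (by fun_prop)
    hL.memLp_two_stdGaussian.integrable_sq
  have hG : MemLp (fun x => gaussianSmooth b f (z + a • x)) 2 (stdGaussian E) :=
    ((hf.gaussianSmooth b).comp_add_smul z a).memLp_two_stdGaussian
  have hv : ∀ x, Var[fun y => f (z + a • x + b • y); stdGaussian E] =
      (∫ y, f (z + (a • x + b • y)) ^ 2 ∂(stdGaussian E)) -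
        gaussianSmooth b f (z + a • x) ^ 2 := by
    intro x
    rw [variance_eq_sub (hf.comp_add_smul _ b).memLp_two_stdGaussian]
    simp only [Pi.pow_apply, gaussianSmooth, add_assoc]
  simp_rw [hv]
  rw [integral_sub i2.integral_prod_left hG.integrable_sq,
    variance_eq_sub hL.memLp_two_stdGaussian, variance_eq_sub hG]
  simp only [Pi.pow_apply]
  rw [e1, e2]
  simp only [gaussianSmooth, add_assoc]
  ring

/-! ### Variance of functions with Lipschitz derivative -/

/-- `f` is `L`-Lipschitz with derivative `a`, which is `M`-Lipschitz. The Taylor estimate is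
part of the definition, so that the class is visibly stable under averaging of translates. -/
structure LipschitzDeriv (L M : ℝ≥0) (f : E → ℝ) (a : E → E →L[ℝ] ℝ) : Prop where
  lip : LipschitzWith L f
  norm_le : ∀ z, ‖a z‖ ≤ L
  lip_deriv : LipschitzWith M a
  taylor : ∀ z y, |f (z + y) - f z - a z y| ≤ M * ‖y‖ ^ 2

lemma LipschitzDeriv.gaussianSmooth {L M : ℝ≥0} {f : E → ℝ} {a : E → E →L[ℝ] ℝ}
    (h : LipschitzDeriv L M f a) (s : ℝ) :
    LipschitzDeriv L M (gaussianSmooth s f) (gaussianSmooth s a) := by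
  have hac := h.lip_deriv.continuous
  have hai : ∀ z, Integrable (fun y => a (z + s • y)) (stdGaussian E) := fun z =>
    Integrable.of_bound (by fun_prop) L (Eventually.of_forall fun y => h.norm_le _)
  have hfi : ∀ z, Integrable (fun y => f (z + s • y)) (stdGaussian E) := fun z =>
    (h.lip.comp_add_smul z s).integrable_stdGaussian
  refine ⟨h.lip.gaussianSmooth s, fun z => ?_, LipschitzWith.of_dist_le_mul fun z z' => ?_,
    fun z y => ?_⟩
  · refine (norm_integral_le_of_norm_le_const (C := L)
      (Eventually.of_forall fun y => h.norm_le _)).trans (by simp)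
  · rw [_root_.gaussianSmooth, _root_.gaussianSmooth, dist_eq_norm, ← integral_sub (hai z) (hai z')]
    refine (norm_integral_le_of_norm_le_const (C := M * dist z z')
      (Eventually.of_forall fun y => ?_)).trans (by simp)
    rw [← dist_eq_norm]
    simpa using h.lip_deriv.dist_le_mul (z + s • y) (z' + s • y)
  · rw [_root_.gaussianSmooth, _root_.gaussianSmooth, _root_.gaussianSmooth,
      ContinuousLinearMap.integral_apply (hai z),
      ← integral_sub (hfi _) (hfi _),
      ← integral_sub (by exact (hfi _).sub (hfi _)) ((hai z).apply_continuousLinearMap y),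
      ← Real.norm_eq_abs]
    refine (norm_integral_le_of_norm_le_const (C := M * ‖y‖ ^ 2)
      (Eventually.of_forall fun w => ?_)).trans (by simp)
    have := h.taylor (z + s • w) y
    rwa [add_right_comm] at this

/-- The weight `s` is later the step size, so that the linear part of a step enters with a factor
close to `1`. -/
lemma add_sq_le_mul_sq_add {s : ℝ} (hs : 0 < s) (p q : ℝ) :
    (p + q) ^ 2 ≤ (1 + s) * p ^ 2 + (1 + s⁻¹) * q ^ 2 := by
  have h : 0 ≤ s⁻¹ * (s * p - q) ^ 2 := by positivity
  have e : s⁻¹ * (s * p - q) ^ 2 = s * p ^ 2 - 2 * p * q + s⁻¹ * q ^ 2 := by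
    field_simp
    ring
  nlinarith

/-- For a small step `s`, the variance of `f (z + s X)` is essentially that of the linear part. -/
lemma LipschitzDeriv.variance_step_le {L M : ℝ≥0} {f : E → ℝ} {a : E → E →L[ℝ] ℝ}
    (h : LipschitzDeriv L M f a) {s : ℝ} (hs : 0 < s) (z : E) :
    Var[fun y => f (z + s • y); stdGaussian E] ≤
      s ^ 2 * ((1 + s) * (L ^ 2 + s * (M ^ 2 * ∫ y, ‖y‖ ^ 4 ∂(stdGaussian E)))) := by
  have h4 : Integrable (fun y : E => ‖y‖ ^ 4) (stdGaussian E) :=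
    (IsGaussian.memLp_id (stdGaussian E) 4 (by norm_num)).integrable_norm_pow (by norm_num)
  have h2 : Integrable (fun y : E => a z y ^ 2) (stdGaussian E) :=
    (IsGaussian.memLp_dual (stdGaussian E) (a z) 2 (by norm_num)).integrable_sq
  have hvar : ∫ y, a z y ^ 2 ∂(stdGaussian E) = ‖a z‖ ^ 2 := by
    rw [← variance_dual_stdGaussian, variance_of_integral_eq_zero (by fun_prop)
      (integral_strongDual_stdGaussian _)]
  have hfl := (h.lip.comp_add_smul z s).memLp_two_stdGaussian
  calc Var[fun y => f (z + s • y); stdGaussian E]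
      ≤ ∫ y, (f (z + s • y) - f z) ^ 2 ∂(stdGaussian E) := variance_le_integral_sub_sq hfl _
    _ ≤ ∫ y, ((1 + s) * s ^ 2 * a z y ^ 2 + (1 + s⁻¹) * (M ^ 2 * s ^ 4) * ‖y‖ ^ 4)
          ∂(stdGaussian E) := by
        refine integral_mono (hfl.sub (memLp_const _)).integrable_sq
          ((h2.const_mul _).add (h4.const_mul _)) fun y => ?_
        have ht := h.taylor z (s • y)
        have hp := add_sq_le_mul_sq_add hs (s * a z y) (f (z + s • y) - f z - a z (s • y))
        have hq : (f (z + s • y) - f z - a z (s • y)) ^ 2 ≤ (M * ‖s • y‖ ^ 2) ^ 2 :=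
          sq_le_sq' (abs_le.mp ht).1 (abs_le.mp ht).2
        have he : (M * ‖s • y‖ ^ 2) ^ 2 = (M : ℝ) ^ 2 * s ^ 4 * ‖y‖ ^ 4 := by
          rw [norm_smul, Real.norm_of_nonneg hs.le]; ring
        rw [map_smul, smul_eq_mul] at hp
        rw [map_smul, smul_eq_mul, he] at hq
        have hsi : 0 ≤ 1 + s⁻¹ := by positivity
        have := mul_le_mul_of_nonneg_left hq hsi
        simp only
        calc (f (z + s • y) - f z) ^ 2
            = (s * a z y + (f (z + s • y) - f z - s * a z y)) ^ 2 := by ring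
          _ ≤ _ := by linarith
    _ = s ^ 2 * ((1 + s) * (‖a z‖ ^ 2 + s * (M ^ 2 * ∫ y, ‖y‖ ^ 4 ∂(stdGaussian E)))) := by
        rw [integral_add (h2.const_mul _) (h4.const_mul _), integral_const_mul,
          integral_const_mul, hvar]
        field_simp
        ring
    _ ≤ _ := by
        have := h.norm_le z
        gcongr

/-- The random vector `s √k X` is a sum of `k` independent steps of the law of `s X`. Each step adds
at most the bound of `variance_step_le`, because the smoothed functions stay in the same class. -/
lemma LipschitzDeriv.variance_sqrt_nat_le {L M : ℝ≥0} {s : ℝ} (hs : 0 < s) (k : ℕ) :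
    ∀ {f : E → ℝ} {a : E → E →L[ℝ] ℝ}, LipschitzDeriv L M f a → ∀ z : E,
    Var[fun y => f (z + (s * √k) • y); stdGaussian E] ≤
      k * (s ^ 2 * ((1 + s) * (L ^ 2 + s * (M ^ 2 * ∫ y, ‖y‖ ^ 4 ∂(stdGaussian E))))) := by
  induction k with
  | zero =>
    intro f a h z
    simp only [Nat.cast_zero, Real.sqrt_zero, mul_zero, zero_smul, add_zero, zero_mul]
    rw [variance_eq_sub (memLp_const _)]
    simp
  | succ k ih =>
    intro f a h z
    rw [variance_eq_integral_variance_add h.lip (a := s * √k) (b := s)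
      (by rw [mul_pow, mul_pow, Real.sq_sqrt (by positivity), Real.sq_sqrt (by positivity)]
          push_cast; ring)]
    have h1 := ih (h.gaussianSmooth s) z
    have h2 : ∫ x, Var[fun y => f (z + (s * √k) • x + s • y); stdGaussian E] ∂(stdGaussian E) ≤
        s ^ 2 * ((1 + s) * (L ^ 2 + s * (M ^ 2 * ∫ y, ‖y‖ ^ 4 ∂(stdGaussian E)))) := by
      refine (integral_mono_of_nonneg (Eventually.of_forall fun x => variance_nonneg _ _)
        (integrable_const _)
        (Eventually.of_forall fun x => h.variance_step_le hs (z + (s * √k) • x))).trans ?_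
      simp
    push_cast
    linarith

/-- Splitting a standard Gaussian vector into ever smaller steps removes the error terms of
`variance_step_le`. -/
lemma LipschitzDeriv.variance_le {L M : ℝ≥0} {f : E → ℝ} {a : E → E →L[ℝ] ℝ}
    (h : LipschitzDeriv L M f a) : Var[f; stdGaussian E] ≤ L ^ 2 := by
  set m := (M : ℝ) ^ 2 * ∫ y, ‖y‖ ^ 4 ∂(stdGaussian E)
  have hlim : Tendsto (fun s : ℝ => (1 + s) * ((L : ℝ) ^ 2 + s * m)) (𝓝 0) (𝓝 ((L : ℝ) ^ 2)) := by
    have : Continuous fun s : ℝ => (1 + s) * ((L : ℝ) ^ 2 + s * m) := by fun_prop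
    simpa using this.tendsto 0
  have hs : Tendsto (fun k : ℕ => (√((k : ℝ) + 1))⁻¹) atTop (𝓝 0) :=
    tendsto_inv_atTop_zero.comp (Real.tendsto_sqrt_atTop.comp
      (tendsto_atTop_add_const_right _ _ tendsto_natCast_atTop_atTop))
  -- `k + 1` steps of scale `1 / √(k + 1)` make up a standard Gaussian vector
  refine ge_of_tendsto' (hlim.comp hs) fun k => ?_
  have hk : 0 < √((k : ℝ) + 1) := by positivity
  have := h.variance_sqrt_nat_le (inv_pos.mpr hk) (k + 1) 0
  have e : (((√((k : ℝ) + 1))⁻¹) ^ 2) = ((k : ℝ) + 1)⁻¹ := by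
    rw [inv_pow, Real.sq_sqrt (by positivity)]
  push_cast at this
  rw [e, inv_mul_cancel₀ hk.ne', ← mul_assoc, mul_inv_cancel₀ (by positivity), one_mul] at this
  simpa using this

/-! ### Mollification and the Gaussian Poincaré inequality for Lipschitz functions -/

open scoped Convolution in
/-- Lipschitz functions are uniform limits of functions with Lipschitz derivative: the convolution
with a smooth bump function keeps the Lipschitz constant, and its derivative is a convolution of
the Lipschitz function with an integrable function. -/
lemma LipschitzWith.exists_lipschitzDeriv_near {L : ℝ≥0} {f : E → ℝ} (hf : LipschitzWith L f)
    {ε : ℝ} (hε : 0 < ε) :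
    ∃ (M : ℝ≥0) (F : E → ℝ) (a : E → E →L[ℝ] ℝ), LipschitzDeriv L M F a ∧
      ∀ z, |f z - F z| ≤ L * ε := by
  let φ : ContDiffBump (0 : E) := ⟨ε / 2, ε, by positivity, by linarith⟩
  set ψ := φ.normed volume with hψ
  have hψs : HasCompactSupport ψ := φ.hasCompactSupport_normed
  have hψ1 : ContDiff ℝ 1 ψ := φ.contDiff_normed
  have hψD : HasCompactSupport (fderiv ℝ ψ) := hψs.fderiv ℝ
  have hψDc : Continuous (fderiv ℝ ψ) := hψ1.continuous_fderiv one_ne_zero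
  have hψi : Integrable ψ volume := hψ1.continuous.integrable_of_hasCompactSupport hψs
  have hDi : Integrable (fderiv ℝ ψ) volume := hψDc.integrable_of_hasCompactSupport hψD
  have hfl : LocallyIntegrable f volume := hf.continuous.locallyIntegrable
  set B : ℝ →L[ℝ] ℝ →L[ℝ] ℝ := ContinuousLinearMap.lsmul ℝ ℝ with hB
  set F := ψ ⋆[B, volume] f with hF
  set a := fderiv ℝ ψ ⋆[B.precompL E, volume] f with ha
  have hd : ∀ z, HasFDerivAt F (a z) z := fun z =>
    hψs.hasFDerivAt_convolution_left B hψ1 hfl z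
  have hBn : ∀ (T : E →L[ℝ] ℝ) (r : ℝ), B.precompL E T r = r • T := by
    intro T r
    ext v
    simp [hB, ContinuousLinearMap.precompL_apply, mul_comm]
  have hFlip : LipschitzWith L F := by
    refine LipschitzWith.of_dist_le_mul fun z z' => ?_
    have i1 := hψs.convolutionExists_left B hψ1.continuous hfl
    rw [dist_eq_norm, hF, convolution_def, convolution_def, ← integral_sub (i1 z) (i1 z')]
    refine (norm_integral_le_of_norm_le (g := fun t => ψ t * (L * dist z z'))
      (hψi.mul_const _) (Eventually.of_forall fun t => ?_)).trans ?_
    · have := hf.dist_le_mul (z - t) (z' - t)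
      rw [dist_sub_right, Real.dist_eq] at this
      simp only [hB, ContinuousLinearMap.lsmul_apply, smul_eq_mul]
      rw [← mul_sub, norm_mul, Real.norm_of_nonneg (φ.nonneg_normed t), Real.norm_eq_abs]
      exact mul_le_mul_of_nonneg_left this (φ.nonneg_normed t)
    · rw [integral_mul_const, φ.integral_normed, one_mul]
  have halip : LipschitzWith (Real.toNNReal (∫ t, ‖fderiv ℝ ψ t‖ ∂(volume : Measure E)) * L) a := by
    refine LipschitzWith.of_dist_le_mul fun z z' => ?_
    have i1 := hψD.convolutionExists_left (B.precompL E) hψDc hfl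
    rw [dist_eq_norm, ha, convolution_def, convolution_def, ← integral_sub (i1 z) (i1 z')]
    refine (norm_integral_le_of_norm_le (g := fun t => ‖fderiv ℝ ψ t‖ * (L * dist z z'))
      (hDi.norm.mul_const _) (Eventually.of_forall fun t => ?_)).trans ?_
    · have := hf.dist_le_mul (z - t) (z' - t)
      rw [dist_sub_right, Real.dist_eq] at this
      rw [hBn, hBn, ← sub_smul, norm_smul, Real.norm_eq_abs, mul_comm]
      exact mul_le_mul_of_nonneg_left this (norm_nonneg _)
    · rw [integral_mul_const, NNReal.coe_mul,
        Real.coe_toNNReal _ (integral_nonneg fun _ => norm_nonneg _), mul_assoc]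
  refine ⟨_, F, a, ⟨hFlip, fun z => ?_, halip, fun z y => ?_⟩, fun z => ?_⟩
  · rw [← (hd z).fderiv]
    exact norm_fderiv_le_of_lipschitz ℝ hFlip
  · have := (convex_closedBall z ‖y‖).norm_image_sub_le_of_norm_hasFDerivWithin_le'
      (f := F) (f' := a) (φ := a z) (x := z) (y := z + y)
      (C := (Real.toNNReal (∫ t, ‖fderiv ℝ ψ t‖ ∂(volume : Measure E)) * L : ℝ≥0) * ‖y‖)
      (fun w _ => (hd w).hasFDerivWithinAt)
      (fun w hw => by
        rw [← dist_eq_norm]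
        refine (halip.dist_le_mul w z).trans ?_
        gcongr
        exact hw)
      (by simp) (by simp)
    rw [add_sub_cancel_left, Real.norm_eq_abs] at this
    rw [sq, ← mul_assoc]
    exact this
  · rw [abs_sub_comm, ← Real.dist_eq]
    refine φ.dist_normed_convolution_le hf.continuous.aestronglyMeasurable fun w hw => ?_
    refine (hf.dist_le_mul w z).trans ?_
    gcongr
    exact (Metric.mem_ball.mp hw).le

/-- The Gaussian Poincaré inequality for Lipschitz functions. -/
theorem LipschitzWith.variance_stdGaussian_le {L : ℝ≥0} {f : E → ℝ} (hf : LipschitzWith L f) :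
    Var[f; stdGaussian E] ≤ L ^ 2 := by
  have hlim : Tendsto (fun ε : ℝ => (1 + ε) * (L : ℝ) ^ 2 + (ε + 1) * (ε * L ^ 2)) (𝓝[>] 0)
      (𝓝 ((L : ℝ) ^ 2)) := by
    have : Continuous fun ε : ℝ => (1 + ε) * (L : ℝ) ^ 2 + (ε + 1) * (ε * L ^ 2) := by fun_prop
    simpa using (this.tendsto 0).mono_left nhdsWithin_le_nhds
  refine ge_of_tendsto hlim (eventually_mem_nhdsWithin.mono fun ε hε => ?_)
  have hε : 0 < ε := hε
  obtain ⟨M, F, a, hF, hfF⟩ := hf.exists_lipschitzDeriv_near hε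
  have h2 := hf.memLp_two_stdGaussian
  have hF2 := hF.lip.memLp_two_stdGaussian
  set c := ∫ y, F y ∂(stdGaussian E)
  have iF : Integrable (fun y => (F y - c) ^ 2) (stdGaussian E) :=
    (hF2.sub (memLp_const c)).integrable_sq
  calc Var[f; stdGaussian E] ≤ ∫ y, (f y - c) ^ 2 ∂(stdGaussian E) :=
        variance_le_integral_sub_sq h2 c
    _ ≤ ∫ y, ((1 + ε) * (F y - c) ^ 2 + (1 + ε⁻¹) * (L * ε) ^ 2) ∂(stdGaussian E) := by
        refine integral_mono (h2.sub (memLp_const c)).integrable_sq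
          ((iF.const_mul _).add (integrable_const _)) fun y => ?_
        have h1 := add_sq_le_mul_sq_add hε (F y - c) (f y - F y)
        have h3 : (f y - F y) ^ 2 ≤ (L * ε) ^ 2 :=
          sq_le_sq' (abs_le.mp (hfF y)).1 (abs_le.mp (hfF y)).2
        have h4 := mul_le_mul_of_nonneg_left h3 (show 0 ≤ 1 + ε⁻¹ by positivity)
        simp only
        calc (f y - c) ^ 2 = (F y - c + (f y - F y)) ^ 2 := by ring
          _ ≤ _ := by linarith
    _ = (1 + ε) * Var[F; stdGaussian E] + (ε + 1) * (ε * L ^ 2) := by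
        rw [integral_add (iF.const_mul _) (integrable_const _), integral_const_mul,
          ← variance_eq_integral hF.lip.continuous.aemeasurable]
        simp
        field_simp
    _ ≤ _ := by
        have := hF.variance_le
        gcongr

end GaussianPoincare

section ConvexGeometry

variable {E : Type*} [NormedAddCommGroup E] [InnerProductSpace ℝ E]

/-! ### Metric projections and support functions -/

/-- `p` is the nearest-point projection onto `K`. For convex `K` the variational inequality
`inner_le` characterizes nearest points. -/
structure IsMetricProj (K : Set E) (p : E → E) : Prop where
  mem : ∀ g, p g ∈ K
  infDist_eq : ∀ g, Metric.infDist g K = ‖g - p g‖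
  inner_le : ∀ g, ∀ w ∈ K, ⟪g - p g, w - p g⟫ ≤ 0

lemma exists_isMetricProj [FiniteDimensional ℝ E] {K : Set E} (hne : K.Nonempty)
    (hcl : IsClosed K) (hc : Convex ℝ K) : ∃ p, IsMetricProj K p := by
  choose p hpK hp using exists_norm_eq_iInf_of_complete_convex hne hcl.isComplete hc
  refine ⟨p, hpK, fun g => ?_, fun g => (norm_eq_iInf_iff_real_inner_le_zero hc (hpK g)).mp (hp g)⟩
  rw [Metric.infDist_eq_iInf, hp g]
  simp_rw [dist_eq_norm]

lemma IsMetricProj.inner_sub_nonneg {K : Set E} {p : E → E} (hp : IsMetricProj K p) (g g' : E) :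
    0 ≤ ⟪(g - p g) - (g' - p g'), p g - p g'⟫ := by
  have h1 := hp.inner_le g (p g') (hp.mem g')
  have h2 := hp.inner_le g' (p g) (hp.mem g)
  have e : ⟪(g - p g) - (g' - p g'), p g - p g'⟫ =
      -⟪g - p g, p g' - p g⟫ - ⟪g' - p g', p g - p g'⟫ := by
    rw [inner_sub_left, ← neg_sub (p g') (p g), inner_neg_right]
  linarith

lemma IsMetricProj.norm_sq_add_norm_sq_le {K : Set E} {p : E → E} (hp : IsMetricProj K p)
    (g g' : E) : ‖(g - p g) - (g' - p g')‖ ^ 2 + ‖p g - p g'‖ ^ 2 ≤ ‖g - g'‖ ^ 2 := by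
  have h := hp.inner_sub_nonneg g g'
  have e : g - g' = ((g - p g) - (g' - p g')) + (p g - p g') := by abel
  rw [e, norm_add_sq_real]
  linarith

lemma IsMetricProj.lipschitzWith {K : Set E} {p : E → E} (hp : IsMetricProj K p) :
    LipschitzWith 1 p := by
  refine LipschitzWith.of_dist_le_mul fun g g' => ?_
  rw [NNReal.coe_one, one_mul, dist_eq_norm, dist_eq_norm]
  refine le_of_sq_le_sq ?_ (norm_nonneg _)
  nlinarith [hp.norm_sq_add_norm_sq_le g g', sq_nonneg ‖(g - p g) - (g' - p g')‖]

lemma IsMetricProj.lipschitzWith_sub {K : Set E} {p : E → E} (hp : IsMetricProj K p) :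
    LipschitzWith 1 (fun g => g - p g) := by
  refine LipschitzWith.of_dist_le_mul fun g g' => ?_
  rw [NNReal.coe_one, one_mul, dist_eq_norm, dist_eq_norm]
  refine le_of_sq_le_sq ?_ (norm_nonneg _)
  nlinarith [hp.norm_sq_add_norm_sq_le g g', sq_nonneg ‖p g - p g'‖]

/-- The support function `y ↦ sup_{s ∈ S} ⟪y, s⟫` of a set `S`. -/
noncomputable def supportFun (S : Set E) (y : E) : ℝ :=
  sSup ((fun s => ⟪y, s⟫) '' S)

lemma inner_le_supportFun {S : Set E} {R : ℝ} (hR : ∀ s ∈ S, ‖s‖ ≤ R) (y : E) {s : E}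
    (hs : s ∈ S) : ⟪y, s⟫ ≤ supportFun S y := by
  refine le_csSup ⟨‖y‖ * R, ?_⟩ ⟨s, hs, rfl⟩
  rintro _ ⟨t, ht, rfl⟩
  exact (real_inner_le_norm y t).trans (by gcongr; exact hR t ht)

lemma supportFun_le {S : Set E} (hne : S.Nonempty) {y : E} {c : ℝ} (h : ∀ s ∈ S, ⟪y, s⟫ ≤ c) :
    supportFun S y ≤ c := by
  refine csSup_le (hne.image _) ?_
  rintro _ ⟨t, ht, rfl⟩
  exact h t ht

lemma lipschitzWith_supportFun {S : Set E} (hne : S.Nonempty) {R : ℝ≥0} (hR : ∀ s ∈ S, ‖s‖ ≤ R) :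
    LipschitzWith R (supportFun S) := by
  refine LipschitzWith.of_le_add_mul R fun y y' => supportFun_le hne fun s hs => ?_
  have h1 := inner_le_supportFun hR y' hs
  have h2 := real_inner_le_norm (y - y') s
  rw [inner_sub_left] at h2
  have h3 : ‖y - y'‖ * ‖s‖ ≤ R * dist y y' := by
    rw [dist_eq_norm, mul_comm]
    gcongr
    exact hR s hs
  linarith

/-! ### The cone generated by a compact convex set in an affine hyperplane -/

/-- The cone `⋃_{τ ≥ 0} τ S` generated by `S`. -/
def coneOver (S : Set E) : Set E :=
  {y | ∃ τ : ℝ, 0 ≤ τ ∧ y ∈ τ • S}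

lemma smul_set_subset_coneOver (S : Set E) {τ : ℝ} (hτ : 0 ≤ τ) : τ • S ⊆ coneOver S :=
  fun _ hy => ⟨τ, hτ, hy⟩

lemma subset_coneOver (S : Set E) : S ⊆ coneOver S :=
  fun y hy => ⟨1, zero_le_one, by simpa using hy⟩

lemma zero_mem_coneOver {S : Set E} (hne : S.Nonempty) : (0 : E) ∈ coneOver S :=
  ⟨0, le_rfl, hne.some, hne.some_mem, by simp⟩

lemma smul_mem_coneOver {S : Set E} {y : E} (hy : y ∈ coneOver S) {c : ℝ} (hc : 0 ≤ c) :
    c • y ∈ coneOver S := by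
  obtain ⟨τ, hτ, s, hs, rfl⟩ := hy
  exact ⟨c * τ, mul_nonneg hc hτ, s, hs, mul_smul c τ s⟩

lemma convex_coneOver {S : Set E} (hS : Convex ℝ S) : Convex ℝ (coneOver S) := by
  rintro y hy z hz a b ha hb -
  obtain ⟨τ, hτ, hy⟩ := smul_mem_coneOver hy ha
  obtain ⟨τ', hτ', hz⟩ := smul_mem_coneOver hz hb
  exact ⟨τ + τ', add_nonneg hτ hτ', by rw [hS.add_smul hτ hτ']; exact Set.add_mem_add hy hz⟩

lemma isClosed_coneOver {S : Set E} (hS : IsCompact S) {x : E} {κ : ℝ} (hκ : 0 < κ)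
    (hx : ∀ s ∈ S, ⟪s, x⟫ = κ) : IsClosed (coneOver S) := by
  refine isClosed_of_closure_subset fun y hy => ?_
  obtain ⟨u, hu, hlim⟩ := mem_closure_iff_seq_limit.mp hy
  choose τ hτ s hs hsu using hu
  -- the multipliers are determined by the linear functional `⟪·, x⟫`, hence converge
  have hτu : ∀ k, ⟪u k, x⟫ / κ = τ k := fun k => by
    rw [← hsu k]
    simp only [real_inner_smul_left, hx _ (hs k)]
    field_simp
  have hτlim : Tendsto τ atTop (𝓝 (⟪y, x⟫ / κ)) := by
    refine Tendsto.congr hτu ?_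
    exact (hlim.inner tendsto_const_nhds).div_const κ
  obtain ⟨s₀, hs₀, φ, hφ, hφlim⟩ := hS.tendsto_subseq hs
  refine ⟨⟪y, x⟫ / κ, ge_of_tendsto' hτlim hτ, s₀, hs₀, ?_⟩
  refine tendsto_nhds_unique ((hτlim.comp hφ.tendsto_atTop).smul hφlim)
    (Tendsto.congr (fun k => ?_) (hlim.comp hφ.tendsto_atTop))
  exact (hsu (φ k)).symm

lemma IsMetricProj.inner_self_eq_zero_of_coneOver {S : Set E} (hne : S.Nonempty) {q : E → E}
    (hq : IsMetricProj (coneOver S) q) (g : E) : ⟪g - q g, q g⟫ = 0 := by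
  have h0 := hq.inner_le g 0 (zero_mem_coneOver hne)
  have h2 := hq.inner_le g _ (smul_mem_coneOver (hq.mem g) zero_le_two)
  rw [zero_sub, inner_neg_right] at h0
  rw [two_smul, add_sub_cancel_right] at h2
  linarith

lemma IsMetricProj.inner_le_zero_of_coneOver {S : Set E} {q : E → E}
    (hq : IsMetricProj (coneOver S) q) (g : E) {s : E} (hs : s ∈ S) : ⟪g - q g, s⟫ ≤ 0 := by
  have h0 := hq.inner_le g s (subset_coneOver S hs)
  have h1 := hq.inner_self_eq_zero_of_coneOver ⟨s, hs⟩ g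
  rw [inner_sub_right] at h0
  linarith

/-! ### The best dilate of the base nearly realizes the distance to the cone -/

/-- Let `p, q` be the projections onto `τ S` and onto the cone over `S`, and write
`q g = τ_g s_g` with `s_g ∈ S`. The squared distances to `τ S` and to the cone differ by at most
`2 (τ_g - τ) σ_S(g - p g)`: this is the first order condition for the convex function
`τ ↦ dist²(g, τ S)`, whose derivative at `τ` is `-2 σ_S(g - p g)`. -/
lemma norm_sq_sub_norm_sq_le {S : Set E} (hne : S.Nonempty) {R : ℝ} (hR : ∀ s ∈ S, ‖s‖ ≤ R)
    {x : E} {κ : ℝ} (hκ : 0 < κ) (hx : ∀ s ∈ S, ⟪s, x⟫ = κ) {τ : ℝ} (hτ : 0 ≤ τ) {p q : E → E}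
    (hp : IsMetricProj (τ • S) p) (hq : IsMetricProj (coneOver S) q) (g : E) :
    ‖g - p g‖ ^ 2 - ‖g - q g‖ ^ 2 ≤ 2 * ((⟪q g, x⟫ / κ - τ) * supportFun S (g - p g)) := by
  have h1 : ‖g - p g‖ ^ 2 - ‖g - q g‖ ^ 2 ≤ 2 * ⟪g - p g, q g - p g⟫ := by
    have e : g - q g = (g - p g) - (q g - p g) := by abel
    rw [e, norm_sub_sq_real (g - p g) (q g - p g)]
    nlinarith [sq_nonneg ‖q g - p g‖]
  have h2 : τ * supportFun S (g - p g) ≤ ⟪g - p g, p g⟫ := by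
    have hle : ∀ s ∈ S, τ * ⟪g - p g, s⟫ ≤ ⟪g - p g, p g⟫ := fun s hs => by
      have := hp.inner_le g (τ • s) (Set.smul_mem_smul_set hs)
      rw [inner_sub_right, real_inner_smul_right] at this
      linarith
    rcases hτ.eq_or_lt with rfl | hτ
    · simpa using hle _ hne.some_mem
    · rw [← le_div_iff₀' hτ]
      exact supportFun_le hne fun s hs => by rw [le_div_iff₀' hτ]; exact hle s hs
  obtain ⟨t, ht, s, hs, hqs⟩ := hq.mem g
  have hqs : t • s = q g := hqs
  have ht' : ⟪q g, x⟫ / κ = t := by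
    rw [← hqs, real_inner_smul_left, hx s hs]
    field_simp
  have h3 : ⟪g - p g, q g⟫ ≤ t * supportFun S (g - p g) := by
    rw [← hqs, real_inner_smul_right]
    exact mul_le_mul_of_nonneg_left (inner_le_supportFun hR _ hs) ht
  rw [inner_sub_right] at h1
  rw [ht']
  linarith

/-- Optimizing the dilation `τ` before instead of after seeing the Gaussian vector costs at most
`2 R / κ`. With `τ = 𝔼 τ_g`, the excess is at most twice the covariance of `τ_g` and of
`σ_S(g - p g)`, and both are Lipschitz functions of `g`, with constants `1 / κ` and `R`. -/
theorem exists_integral_infDist_smul_sq_le [FiniteDimensional ℝ E] [MeasurableSpace E]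
    [BorelSpace E] {S : Set E} (hne : S.Nonempty) (hS : IsCompact S) (hconv : Convex ℝ S) {R : ℝ}
    (hR : ∀ s ∈ S, ‖s‖ ≤ R) {x : E} (hx1 : ‖x‖ = 1) {κ : ℝ} (hκ : 0 < κ)
    (hx : ∀ s ∈ S, ⟪s, x⟫ = κ) :
    ∃ τ : ℝ, 0 ≤ τ ∧ ∫ g, Metric.infDist g (τ • S) ^ 2 ∂(stdGaussian E) ≤
      ∫ g, Metric.infDist g (coneOver S) ^ 2 ∂(stdGaussian E) + 2 * R / κ := by
  obtain ⟨q, hq⟩ := exists_isMetricProj ⟨_, zero_mem_coneOver hne⟩ (isClosed_coneOver hS hκ hx)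
    (convex_coneOver hconv)
  have hRκ : κ ≤ R := by
    obtain ⟨s, hs⟩ := hne
    rw [← hx s hs]
    exact (real_inner_le_norm s x).trans (by rw [hx1, mul_one]; exact hR s hs)
  have hR0 : 0 < R := hκ.trans_le hRκ
  lift R to ℝ≥0 using hR0.le
  set T : E → ℝ := fun g => ⟪q g, x⟫ / κ with hT
  have hT0 : ∀ g, 0 ≤ T g := fun g => by
    obtain ⟨t, ht, s, hs, hqs⟩ := hq.mem g
    have hqs : t • s = q g := hqs
    simp only [hT]
    rw [← hqs, real_inner_smul_left, hx s hs]
    positivity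
  have hTl : LipschitzWith (κ⁻¹).toNNReal T := by
    refine LipschitzWith.of_dist_le_mul fun g g' => ?_
    rw [Real.coe_toNNReal _ (by positivity), Real.dist_eq]
    simp only [hT]
    rw [← sub_div, ← inner_sub_left, abs_div, abs_of_pos hκ, inv_mul_eq_div]
    gcongr
    refine (abs_real_inner_le_norm _ _).trans ?_
    rw [hx1, mul_one, ← dist_eq_norm]
    simpa using hq.lipschitzWith.dist_le_mul g g'
  set τ := ∫ g, T g ∂(stdGaussian E) with hτdef
  have hτ : 0 ≤ τ := integral_nonneg hT0
  obtain ⟨p, hp⟩ := exists_isMetricProj (hne.smul_set (a := τ)) (hS.smul τ).isClosed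
    (hconv.smul τ)
  set H : E → ℝ := fun g => supportFun S (g - p g)
  have hHl : LipschitzWith R H := by
    have := (lipschitzWith_supportFun hne hR).comp hp.lipschitzWith_sub
    rwa [mul_one] at this
  set m := ∫ g, H g ∂(stdGaussian E)
  refine ⟨τ, hτ, ?_⟩
  have iT : MemLp (fun g => T g - τ) 2 (stdGaussian E) :=
    hTl.memLp_two_stdGaussian.sub (memLp_const τ)
  have iH : MemLp (fun g => H g - m) 2 (stdGaussian E) :=
    hHl.memLp_two_stdGaussian.sub (memLp_const m)
  have hT1 : ∫ g, (T g - τ) ∂(stdGaussian E) = 0 := by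
    rw [integral_sub hTl.integrable_stdGaussian (integrable_const _)]
    simp [hτdef]
  have iD : Integrable (fun g => Metric.infDist g (coneOver S) ^ 2) (stdGaussian E) :=
    (Metric.lipschitz_infDist_pt (coneOver S)).memLp_two_stdGaussian.integrable_sq
  have iD' : Integrable (fun g => Metric.infDist g (τ • S) ^ 2) (stdGaussian E) :=
    (Metric.lipschitz_infDist_pt (τ • S)).memLp_two_stdGaussian.integrable_sq
  have i1 : Integrable (fun g => κ * R * (T g - τ) ^ 2) (stdGaussian E) :=
    iT.integrable_sq.const_mul _
  have i2 : Integrable (fun g => (κ * R)⁻¹ * (H g - m) ^ 2) (stdGaussian E) :=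
    iH.integrable_sq.const_mul _
  have i3 : Integrable (fun g => 2 * m * (T g - τ)) (stdGaussian E) :=
    (iT.integrable one_le_two).const_mul _
  calc ∫ g, Metric.infDist g (τ • S) ^ 2 ∂(stdGaussian E)
      ≤ ∫ g, (Metric.infDist g (coneOver S) ^ 2 + (κ * R * (T g - τ) ^ 2 +
          (κ * R)⁻¹ * (H g - m) ^ 2 + 2 * m * (T g - τ))) ∂(stdGaussian E) := by
        refine integral_mono iD' (iD.add ((i1.add i2).add i3)) fun g => ?_
        have h1 := norm_sq_sub_norm_sq_le hne hR hκ hx hτ hp hq g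
        rw [← hp.infDist_eq, ← hq.infDist_eq] at h1
        change _ ≤ 2 * ((T g - τ) * H g) at h1
        have h2 : 0 ≤ (κ * R)⁻¹ * (κ * R * (T g - τ) - (H g - m)) ^ 2 := by positivity
        have e : (κ * R)⁻¹ * (κ * R * (T g - τ) - (H g - m)) ^ 2 =
            κ * R * (T g - τ) ^ 2 + (κ * R)⁻¹ * (H g - m) ^ 2 - 2 * ((T g - τ) * (H g - m)) := by
          field_simp
          ring
        simp only
        linarith
    _ = ∫ g, Metric.infDist g (coneOver S) ^ 2 ∂(stdGaussian E) +
          (κ * R * Var[T; stdGaussian E] + (κ * R)⁻¹ * Var[H; stdGaussian E]) := by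
        rw [integral_add iD (by exact (i1.add i2).add i3), integral_add (by exact i1.add i2) i3,
          integral_add i1 i2, integral_const_mul, integral_const_mul, integral_const_mul, hT1,
          variance_eq_integral hTl.continuous.aemeasurable,
          variance_eq_integral hHl.continuous.aemeasurable, mul_zero, add_zero]
    _ ≤ ∫ g, Metric.infDist g (coneOver S) ^ 2 ∂(stdGaussian E) +
          (κ * R * κ⁻¹ ^ 2 + (κ * R)⁻¹ * R ^ 2) := by
        have hv1 := hTl.variance_stdGaussian_le
        have hv2 := hHl.variance_stdGaussian_le
        rw [Real.coe_toNNReal _ (by positivity)] at hv1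
        gcongr
    _ = _ := by
        field_simp
        ring

end ConvexGeometry

namespace PhaseOnly

variable {n : ℕ}

/-! ### The subdifferential of a norm and the descent cone -/

section Subdifferential

variable (f : Seminorm ℝ (Vec n)) {x : Vec n}

lemma continuous_seminorm : Continuous f :=
  continuousOn_univ.mp (f.convexOn.continuousOn isOpen_univ)

variable {f}

lemma inner_self_eq_of_mem_subdiff {u : Vec n} (hu : u ∈ subdiff f x) : ⟪u, x⟫ = f x := by
  have h0 := hu 0
  have h2 := hu ((2 : ℝ) • x)
  rw [zero_sub, inner_neg_right, map_zero] at h0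
  rw [two_smul, add_sub_cancel_right, ← two_smul ℝ, map_smul_eq_mul, Real.norm_of_nonneg zero_le_two]
    at h2
  linarith

lemma inner_le_of_mem_subdiff {u : Vec n} (hu : u ∈ subdiff f x) (y : Vec n) : ⟪u, y⟫ ≤ f y := by
  have h := hu y
  rw [inner_sub_right, inner_self_eq_of_mem_subdiff hu] at h
  linarith

lemma isClosed_subdiff : IsClosed (subdiff f x) := by
  simp only [subdiff, Set.ofPred_forall]
  exact isClosed_iInter fun y => isClosed_le (by fun_prop) continuous_const

lemma convex_subdiff : Convex ℝ (subdiff f x) := by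
  intro u hu v hv a b ha hb hab y
  have h1 := mul_le_mul_of_nonneg_left (hu y) ha
  have h2 := mul_le_mul_of_nonneg_left (hv y) hb
  rw [inner_add_left, real_inner_smul_left, real_inner_smul_left]
  have e : ∀ r : ℝ, r = a * r + b * r := fun r => by rw [← add_mul, hab, one_mul]
  rw [e (f x), e (f y)]
  linarith

lemma isCompact_subdiff : IsCompact (subdiff f x) := by
  obtain ⟨C, hC, hb⟩ := Seminorm.bound_of_continuous_normedSpace f (continuous_seminorm f)
  refine Metric.isCompact_of_isClosed_isBounded isClosed_subdiff
    ((Metric.isBounded_closedBall (x := (0 : Vec n)) (r := C)).subset fun u hu => ?_)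
  rw [mem_closedBall_zero_iff]
  have h := (inner_le_of_mem_subdiff hu u).trans (hb u)
  rw [real_inner_self_eq_norm_sq] at h
  by_contra! hlt
  nlinarith

/-- If `f` nowhere drops below `f x` along the ray from `x` in direction `v`, then some subgradient
has a nonnegative inner product with `v`: it is obtained by separating the ray from the open
sublevel set of `f`. -/
lemma exists_mem_subdiff_inner_nonneg (hx : 0 < f x) {v : Vec n}
    (hv : ∀ t : ℝ, 0 < t → f x ≤ f (x + t • v)) : ∃ u ∈ subdiff f x, 0 ≤ ⟪u, v⟫ := by
  have hA : Convex ℝ {y | f y < f x} := by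
    simpa using f.convexOn.convex_lt (f x)
  have hAo : IsOpen {y | f y < f x} := isOpen_lt (continuous_seminorm f) continuous_const
  have hray : Convex ℝ ((fun t : ℝ => x + t • v) '' Set.Ici 0) := by
    rintro _ ⟨s, hs, rfl⟩ _ ⟨t, ht, rfl⟩ a b ha hb hab
    refine ⟨a * s + b * t, add_nonneg (mul_nonneg ha hs) (mul_nonneg hb ht), ?_⟩
    have : x = a • x + b • x := by rw [← add_smul, hab, one_smul]
    simp only
    nth_rw 1 [this]
    module
  have hdisj : Disjoint {y | f y < f x} ((fun t : ℝ => x + t • v) '' Set.Ici 0) := by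
    rw [Set.disjoint_left]
    rintro _ hy ⟨t, ht, rfl⟩
    rcases (show (0 : ℝ) ≤ t from ht).eq_or_lt with rfl | ht
    · simp at hy
    · exact absurd hy (not_lt.mpr (hv t ht))
  obtain ⟨ℓ, c, hℓ, hc⟩ := geometric_hahn_banach_open hA hAo hray hdisj
  have hc0 : 0 < c := by simpa using hℓ 0 (by simpa using hx)
  have hcx : c ≤ ℓ x := by simpa using hc (x + (0 : ℝ) • v) ⟨0, Set.mem_Ici.mpr le_rfl, rfl⟩
  -- by homogeneity, the separation bounds `ℓ` by a multiple of `f`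
  have hℓf : ∀ y, ℓ y ≤ c / f x * f y := by
    intro y
    refine le_of_forall_pos_le_add fun ε hε => ?_
    set r := f y + ε * f x / c with hr
    have hr0 : 0 < r := add_pos_of_nonneg_of_pos (apply_nonneg f y) (by positivity)
    have hlt : f ((f x / r) • y) < f x := by
      rw [map_smul_eq_mul, Real.norm_of_nonneg (by positivity), div_mul_eq_mul_div,
        div_lt_iff₀ hr0]
      have : f y < r := by rw [hr]; linarith [show 0 < ε * f x / c by positivity]
      gcongr
    have h1 := hℓ _ hlt
    rw [map_smul, smul_eq_mul, div_mul_eq_mul_div, div_lt_iff₀ hr0] at h1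
    have h2 : c / f x * f y + ε = c * r / f x := by
      rw [hr]; field_simp
    rw [h2, le_div_iff₀ hx]
    linarith
  have hℓx : ℓ x = c := le_antisymm ((hℓf x).trans_eq (by field_simp)) hcx
  have hℓv : 0 ≤ ℓ v := by
    have := hc (x + (1 : ℝ) • v) ⟨1, Set.mem_Ici.mpr zero_le_one, rfl⟩
    rw [one_smul, map_add, hℓx] at this
    linarith
  have hu : ∀ y, ⟪(f x / c) • (InnerProductSpace.toDual ℝ (Vec n)).symm ℓ, y⟫ = f x / c * ℓ y :=
    fun y => by rw [real_inner_smul_left, InnerProductSpace.toDual_symm_apply]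
  refine ⟨(f x / c) • (InnerProductSpace.toDual ℝ (Vec n)).symm ℓ, fun y => ?_, ?_⟩
  · rw [hu, map_sub, hℓx]
    have h1 := mul_le_mul_of_nonneg_left (hℓf y) (show 0 ≤ f x / c by positivity)
    have h2 : f x / c * (c / f x * f y) = f y := by field_simp
    have h3 : f x / c * c = f x := by field_simp
    rw [mul_sub, h3]
    linarith
  · rw [hu]
    positivity

lemma nonempty_subdiff (hx : 0 < f x) : (subdiff f x).Nonempty := by
  obtain ⟨u, hu, -⟩ := exists_mem_subdiff_inner_nonneg hx (v := 0) (fun t _ => by simp)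
  exact ⟨u, hu⟩

/-- The descent cone contains the interior of the polar cone of the subdifferential. -/
lemma mem_descentCone_of_inner_neg (hx : 0 < f x) {v : Vec n}
    (hv : ∀ u ∈ subdiff f x, ⟪u, v⟫ < 0) : v ∈ descentCone f x := by
  by_contra hn
  simp only [descentCone, Set.mem_ofPred_eq, not_exists, not_and, not_le] at hn
  obtain ⟨u, hu, huv⟩ := exists_mem_subdiff_inner_nonneg hx fun t ht => (hn t ht).le
  exact absurd huv (not_le.mpr (hv u hu))

lemma inner_nonpos_of_mem_descentCone {u v : Vec n} (hu : u ∈ subdiff f x)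
    (hv : v ∈ descentCone f x) : ⟪u, v⟫ ≤ 0 := by
  obtain ⟨t, ht, hft⟩ := hv
  have h := hu (x + t • v)
  rw [add_sub_cancel_left, real_inner_smul_right] at h
  nlinarith

lemma smul_mem_descentCone {v : Vec n} (hv : v ∈ descentCone f x) {c : ℝ} (hc : 0 < c) :
    c • v ∈ descentCone f x := by
  obtain ⟨t, ht, hft⟩ := hv
  exact ⟨t / c, by positivity, by rwa [smul_smul, div_mul_cancel₀ _ hc.ne']⟩

lemma neg_mem_descentCone : -x ∈ descentCone f x :=
  ⟨1, one_pos, by simp⟩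

end Subdifferential

/-! ### The linear map `Q` and the scaled subdifferential -/

section Scaling

variable {f : Seminorm ℝ (Vec n)} {x : Vec n}

lemma inner_QInv_left (hx : ‖x‖ = 1) (u v : Vec n) : ⟪QInv x u, v⟫ = ⟪u, QInv x v⟫ := by
  rw [QInv_apply hx, QInv_apply hx]
  simp only [inner_sub_left, inner_sub_right, real_inner_smul_left, real_inner_smul_right]
  rw [real_inner_comm x u]
  ring

lemma QInv_Q (hx : ‖x‖ = 1) (u : Vec n) : QInv x (Q x u) = u :=
  (Q_isInvertible hx).inverse_apply_self u

lemma Q_QInv (hx : ‖x‖ = 1) (u : Vec n) : Q x (QInv x u) = u :=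
  (Q_isInvertible hx).self_apply_inverse u

lemma Q_self (hx : ‖x‖ = 1) : Q x x = √(Real.pi / 2) • x := by
  rw [Q_apply, real_inner_self_eq_norm_sq, hx]
  module

lemma QInv_self (hx : ‖x‖ = 1) : QInv x x = √(2 / Real.pi) • x := by
  rw [QInv_apply hx, real_inner_self_eq_norm_sq, hx]
  module

lemma inner_orthogonal_self (hx : ‖x‖ = 1) (g : Vec n) : ⟪g - ⟪x, g⟫ • x, x⟫ = 0 := by
  rw [inner_sub_left, real_inner_smul_left, real_inner_self_eq_norm_sq, hx, real_inner_comm]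
  ring

lemma inner_orthogonal_Q (hx : ‖x‖ = 1) (g u : Vec n) :
    ⟪g - ⟪x, g⟫ • x, Q x u⟫ = ⟪g - ⟪x, g⟫ • x, u⟫ := by
  rw [Q_apply, inner_add_right, real_inner_smul_right, real_inner_smul_right,
    inner_orthogonal_self hx]
  ring

lemma isCompact_scaledSubdiff : IsCompact (scaledSubdiff f x) :=
  isCompact_subdiff.image (QInv x).continuous

lemma convex_scaledSubdiff : Convex ℝ (scaledSubdiff f x) :=
  convex_subdiff.linear_image (QInv x).toLinearMap

/-- The scaled subdifferential lies in a hyperplane orthogonal to `x`. -/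
lemma inner_of_mem_scaledSubdiff (hx : ‖x‖ = 1) {s : Vec n} (hs : s ∈ scaledSubdiff f x) :
    ⟪s, x⟫ = √(2 / Real.pi) * f x := by
  obtain ⟨u, hu, rfl⟩ := hs
  rw [inner_QInv_left hx, QInv_self hx, real_inner_smul_right, inner_self_eq_of_mem_subdiff hu]

lemma inner_Q_nonpos (hx : ‖x‖ = 1) {s v : Vec n} (hs : s ∈ scaledSubdiff f x)
    (hv : v ∈ descentCone f x) : ⟪s, Q x v⟫ ≤ 0 := by
  obtain ⟨u, hu, rfl⟩ := hs
  rw [inner_QInv_left hx, QInv_Q hx]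
  exact inner_nonpos_of_mem_descentCone hu hv

lemma norm_le_rad {s : Vec n} (hs : s ∈ scaledSubdiff f x) : ‖s‖ ≤ rad (scaledSubdiff f x) :=
  le_csSup (isCompact_scaledSubdiff.image continuous_norm).bddAbove ⟨s, hs, rfl⟩

end Scaling

/-! ### The width of the constraint set -/

section Width

variable {f : Seminorm ℝ (Vec n)} {x : Vec n}

lemma norm_le_of_mem_constraintSet (hx : ‖x‖ = 1) {u : Vec n} (hu : u ∈ constraintSet f x) :
    ‖u‖ ≤ ‖QInv x‖₊ := by
  have h := (QInv x).le_opNorm (Q x u)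
  rwa [QInv_Q hx, hu.2, mul_one] at h

lemma neg_smul_mem_constraintSet (hx : ‖x‖ = 1) : √(2 / Real.pi) • -x ∈ constraintSet f x := by
  have h0 : 0 < √(2 / Real.pi) := by positivity
  refine ⟨smul_mem_descentCone neg_mem_descentCone h0, ?_⟩
  rw [map_smul, map_neg, Q_self hx, norm_smul, norm_neg, norm_smul, hx, mul_one,
    Real.norm_of_nonneg h0.le, Real.norm_of_nonneg (by positivity), mul_comm, sqrt_aux]

lemma widthFun_eq_supportFun (g : Vec n) :
    widthFun f x g = supportFun (constraintSet f x) (g - ⟪x, g⟫ • x) := rfl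

lemma exists_lipschitzWith_widthFun (hx : ‖x‖ = 1) : ∃ K, LipschitzWith K (widthFun f x) := by
  have h := lipschitzWith_supportFun ⟨_, neg_smul_mem_constraintSet (f := f) hx⟩
    fun s hs => norm_le_of_mem_constraintSet hx hs
  have h2 := (ContinuousLinearMap.id ℝ (Vec n) - (innerSL ℝ x).smulRight x).lipschitz
  exact ⟨_, h.comp h2⟩

lemma inner_le_widthFun_mul (hx : ‖x‖ = 1) (g : Vec n) {u : Vec n} (hu : u ∈ descentCone f x) :
    ⟪g - ⟪x, g⟫ • x, u⟫ ≤ widthFun f x g * ‖Q x u‖ := by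
  rcases (norm_nonneg (Q x u)).eq_or_lt with h0 | h0
  · have : u = 0 := by
      rw [← QInv_Q hx u, norm_eq_zero.mp h0.symm, map_zero]
    simp [this]
  · have hmem : ‖Q x u‖⁻¹ • u ∈ constraintSet f x := by
      refine ⟨smul_mem_descentCone hu (inv_pos.mpr h0), ?_⟩
      rw [map_smul, norm_smul, norm_inv, norm_norm, inv_mul_cancel₀ h0.ne']
    have h := inner_le_supportFun (fun s hs => norm_le_of_mem_constraintSet hx hs)
      (g - ⟪x, g⟫ • x) hmem
    rwa [real_inner_smul_right, ← widthFun_eq_supportFun, inv_mul_le_iff₀ h0, mul_comm] at h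

/-- The constraint set contains a multiple of `-x`, which is orthogonal to `(I - x xᵀ) g`. -/
lemma widthFun_nonneg (hx : ‖x‖ = 1) (g : Vec n) : 0 ≤ widthFun f x g := by
  have h := inner_le_supportFun (fun s hs => norm_le_of_mem_constraintSet hx hs)
    (g - ⟪x, g⟫ • x) (neg_smul_mem_constraintSet (f := f) hx)
  rwa [real_inner_smul_right, inner_neg_right, inner_orthogonal_self hx, neg_zero, mul_zero] at h

lemma inner_Q_le_infDist (hf : 0 < f x) (hx : ‖x‖ = 1) {τ : ℝ} (hτ : 0 ≤ τ) (g : Vec n) {u : Vec n}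
    (hu : u ∈ constraintSet f x) : ⟪g, Q x u⟫ ≤ Metric.infDist g (τ • scaledSubdiff f x) := by
  obtain ⟨s, hs⟩ : (scaledSubdiff f x).Nonempty := (nonempty_subdiff hf).image _
  refine (Metric.le_infDist ⟨_, Set.smul_mem_smul_set hs⟩).mpr ?_
  rintro _ ⟨s, hs, rfl⟩
  have h1 := inner_Q_nonpos hx hs hu.1
  have h2 := real_inner_le_norm (g - τ • s) (Q x u)
  rw [hu.2, mul_one, inner_sub_left, real_inner_smul_left] at h2
  rw [dist_eq_norm]
  nlinarith

/-- The reflection across the hyperplane orthogonal to `x`. -/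
noncomputable def hyperplaneReflection (x : Vec n) : Vec n ≃ₗᵢ[ℝ] Vec n :=
  (ℝ ∙ x)ᗮ.reflection

lemma hyperplaneReflection_apply (hx : ‖x‖ = 1) (g : Vec n) :
    hyperplaneReflection x g = g - (2 * ⟪x, g⟫) • x := by
  rw [hyperplaneReflection, Submodule.reflection_orthogonal_apply,
    Submodule.reflection_singleton_apply]
  simp only [hx]
  simp
  module

/-- Averaging over the reflection removes the component of `g` along `x`. -/
lemma widthFun_le_average_infDist (hf : 0 < f x) (hx : ‖x‖ = 1) {τ : ℝ} (hτ : 0 ≤ τ) (g : Vec n) :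
    widthFun f x g ≤ 2⁻¹ * (Metric.infDist g (τ • scaledSubdiff f x) +
      Metric.infDist (hyperplaneReflection x g) (τ • scaledSubdiff f x)) := by
  rw [widthFun_eq_supportFun]
  refine supportFun_le ⟨_, neg_smul_mem_constraintSet hx⟩ fun u hu => ?_
  have h1 := inner_Q_le_infDist hf hx hτ g hu
  have h2 := inner_Q_le_infDist hf hx hτ (hyperplaneReflection x g) hu
  have e : g - ⟪x, g⟫ • x = (2 : ℝ)⁻¹ • (g + hyperplaneReflection x g) := by
    rw [hyperplaneReflection_apply hx]
    module
  rw [← inner_orthogonal_Q hx, e, real_inner_smul_left, inner_add_left]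
  gcongr

lemma integral_comp_hyperplaneReflection (x : Vec n) {F : Vec n → ℝ} (hF : Continuous F) :
    ∫ g, F (hyperplaneReflection x g) ∂(gaussianLaw n) = ∫ g, F g ∂(gaussianLaw n) := by
  have h : (gaussianLaw n).map (hyperplaneReflection x) = gaussianLaw n := stdGaussian_map _
  conv_rhs => rw [← h]
  rw [integral_map (by fun_prop) hF.aestronglyMeasurable]

lemma integral_widthFun_le (hf : 0 < f x) (hx : ‖x‖ = 1) {τ : ℝ} (hτ : 0 ≤ τ) :
    ∫ g, widthFun f x g ∂(gaussianLaw n) ≤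
      ∫ g, Metric.infDist g (τ • scaledSubdiff f x) ∂(gaussianLaw n) := by
  obtain ⟨K, hK⟩ := exists_lipschitzWith_widthFun (f := f) hx
  have hD := Metric.lipschitz_infDist_pt (τ • scaledSubdiff f x)
  have hDi := hD.integrable_stdGaussian
  have hRi := (hD.comp (hyperplaneReflection x).lipschitz).integrable_stdGaussian
  refine (integral_mono hK.integrable_stdGaussian ((hDi.add hRi).const_mul 2⁻¹)
    fun g => widthFun_le_average_infDist hf hx hτ g).trans_eq ?_
  rw [integral_const_mul, integral_add' hDi hRi]
  simp only [Function.comp_apply]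
  rw [integral_comp_hyperplaneReflection x hD.continuous]
  ring

lemma zetaPO_le_integral (hf : 0 < f x) (hx : ‖x‖ = 1) {τ : ℝ} (hτ : 0 ≤ τ) :
    zetaPO f x ≤ ∫ g, Metric.infDist g (τ • scaledSubdiff f x) ^ 2 ∂(gaussianLaw n) := by
  have h0 : 0 ≤ ∫ g, widthFun f x g ∂(gaussianLaw n) := integral_nonneg (widthFun_nonneg hx)
  have hv := variance_nonneg (fun g => Metric.infDist g (τ • scaledSubdiff f x)) (gaussianLaw n)
  rw [variance_eq_sub (Metric.lipschitz_infDist_pt _).memLp_two_stdGaussian] at hv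
  calc zetaPO f x ≤ (∫ g, Metric.infDist g (τ • scaledSubdiff f x) ∂(gaussianLaw n)) ^ 2 :=
        pow_le_pow_left₀ h0 (integral_widthFun_le hf hx hτ) 2
    _ ≤ _ := sub_nonneg.mp hv

/-- Up to the component of `g` along `x`, the width is the distance to the cone generated by the
scaled subdifferential. The residual `r` of the projection onto that cone lies in the polar cone,
hence its translate `r - ε x` lies in the image of the descent cone under `Q`. -/
lemma infDist_coneOver_le (hf : 0 < f x) (hx : ‖x‖ = 1) (g : Vec n) :
    Metric.infDist g (coneOver (scaledSubdiff f x)) ≤ widthFun f x g + |⟪x, g⟫| := by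
  have hne : (scaledSubdiff f x).Nonempty := (nonempty_subdiff hf).image _
  obtain ⟨q, hq⟩ := exists_isMetricProj ⟨_, zero_mem_coneOver hne⟩
    (isClosed_coneOver isCompact_scaledSubdiff (by positivity)
      (fun s hs => inner_of_mem_scaledSubdiff hx hs)) (convex_coneOver convex_scaledSubdiff)
  rw [hq.infDist_eq]
  set r := g - q g with hr
  have hrr : ⟪g, r⟫ = ‖r‖ ^ 2 := by
    have h := hq.inner_self_eq_zero_of_coneOver hne g
    rw [← hr] at h
    rw [← real_inner_self_eq_norm_sq, ← sub_eq_zero, ← inner_sub_left]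
    rw [show g - r = q g by rw [hr]; abel, real_inner_comm]
    exact h
  have hε : ∀ ε : ℝ, 0 < ε → ⟪g - ⟪x, g⟫ • x, r⟫ ≤
      widthFun f x g * (‖r‖ + ε * √(Real.pi / 2)) := by
    intro ε hε
    have hmem : QInv x r - ε • x ∈ descentCone f x := by
      refine mem_descentCone_of_inner_neg hf fun u hu => ?_
      have h := hq.inner_le_zero_of_coneOver g (s := QInv x u) ⟨u, hu, rfl⟩
      rw [real_inner_comm, inner_QInv_left hx] at h
      rw [inner_sub_right, real_inner_smul_right, inner_self_eq_of_mem_subdiff hu]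
      have : 0 < ε * f x := by positivity
      linarith
    have h := inner_le_widthFun_mul hx g hmem
    rw [← inner_orthogonal_Q hx, map_sub, Q_QInv hx, map_smul, Q_self hx, inner_sub_right,
      real_inner_smul_right, real_inner_smul_right, inner_orthogonal_self hx, mul_zero, mul_zero,
      sub_zero] at h
    refine h.trans (mul_le_mul_of_nonneg_left ((norm_sub_le _ _).trans_eq ?_)
      (widthFun_nonneg hx g))
    rw [norm_smul, norm_smul, hx, mul_one, Real.norm_of_nonneg hε.le,
      Real.norm_of_nonneg (by positivity)]
  have hlim : ⟪g - ⟪x, g⟫ • x, r⟫ ≤ widthFun f x g * ‖r‖ := by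
    have hc : Continuous fun ε : ℝ => widthFun f x g * (‖r‖ + ε * √(Real.pi / 2)) := by fun_prop
    refine ge_of_tendsto (x := 𝓝[>] (0 : ℝ))
      (f := fun ε : ℝ => widthFun f x g * (‖r‖ + ε * √(Real.pi / 2))) ?_
      (eventually_mem_nhdsWithin.mono fun ε h => hε ε h)
    simpa using (hc.tendsto 0).mono_left nhdsWithin_le_nhds
  have hxr : ⟪x, g⟫ * ⟪x, r⟫ ≤ |⟪x, g⟫| * ‖r‖ := by
    refine (le_abs_self _).trans ?_
    rw [abs_mul]
    gcongr
    simpa [hx] using abs_real_inner_le_norm x r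
  have hsq : ‖r‖ ^ 2 ≤ (widthFun f x g + |⟪x, g⟫|) * ‖r‖ := by
    rw [inner_sub_left, real_inner_smul_left, hrr] at hlim
    linarith
  by_contra! hlt
  have h0 : 0 ≤ widthFun f x g + |⟪x, g⟫| := add_nonneg (widthFun_nonneg hx g) (abs_nonneg _)
  nlinarith

end Width

/-! ### Assembling the estimates -/

lemma integral_abs_gaussianReal : ∫ t, |t| ∂(gaussianReal 0 1) = √(2 / Real.pi) := by
  rw [integral_gaussianReal_eq_integral_smul one_ne_zero]
  have e : ∀ t : ℝ, gaussianPDFReal 0 1 t • |t| =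
      (√(2 * Real.pi))⁻¹ * (|t| * Real.exp (-(1 / 2) * |t| ^ (2 : ℝ))) := fun t => by
    rw [gaussianPDFReal, smul_eq_mul, Real.rpow_two, sq_abs]
    simp only [NNReal.coe_one, mul_one, sub_zero]
    rw [show -t ^ 2 / 2 = -(1 / 2) * t ^ 2 by ring]
    ring
  simp_rw [e]
  rw [integral_const_mul, integral_comp_abs (f := fun t => t * Real.exp (-(1 / 2) * t ^ (2 : ℝ)))]
  have h := integral_rpow_mul_exp_neg_mul_rpow (p := 2) (q := 1) (b := 1 / 2) two_pos
    (by norm_num) (by norm_num)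
  simp only [Real.rpow_one] at h
  rw [h]
  rw [show (2 / Real.pi : ℝ) = 2 * 2 / (2 * Real.pi) by field_simp,
    Real.sqrt_div (show (0 : ℝ) ≤ 2 * 2 by norm_num), Real.sqrt_mul_self zero_le_two]
  norm_num [Real.rpow_neg_one]
  field_simp

lemma integral_abs_inner_gaussianLaw {x : Vec n} (hx : ‖x‖ = 1) :
    ∫ g, |⟪x, g⟫| ∂(gaussianLaw n) = √(2 / Real.pi) := by
  have h := IsGaussian.map_eq_gaussianReal (μ := gaussianLaw n) (innerSL ℝ x)
  rw [integral_strongDual_stdGaussian, variance_dual_stdGaussian, innerSL_apply_norm, hx, one_pow,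
    Real.toNNReal_one] at h
  rw [← integral_abs_gaussianReal, ← h, integral_map (by fun_prop) (by fun_prop)]
  rfl

/-- The arithmetic that combines the estimates: `m` and `w` are the expected distance to the cone
and the expected width, `d` is the expected squared distance, `ζ` the surrogate, `c = √(2/π)`, and
`r` the radius term. The case `m < c` is treated apart, since `m - c ≤ w` cannot be squared there;
there the left-hand side is nonpositive. -/
lemma lower_bound_arith {c m w d ζ r : ℝ} (hc0 : 0 ≤ c) (hc1 : c ≤ 1) (hm : 0 ≤ m)
    (hr : 0 ≤ r) (hmw : m ≤ w + c) (hd : d ≤ m ^ 2 + 1) (hmd : m ^ 2 ≤ d) (hdζ : d ≤ ζ)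
    (hζ : ζ ≤ d + r) : ζ - 2 * c * √ζ - r - (1 - c ^ 2) ≤ w ^ 2 := by
  have hζ0 : 0 ≤ ζ := (sq_nonneg m).trans (hmd.trans hdζ)
  have hsq : √ζ ^ 2 = ζ := Real.sq_sqrt hζ0
  have hy0 : 0 ≤ √ζ := Real.sqrt_nonneg ζ
  have hmy : m ≤ √ζ := Real.le_sqrt_of_sq_le (hmd.trans hdζ)
  rcases le_total c m with h | h
  · have h1 : (m - c) ^ 2 ≤ w ^ 2 := pow_le_pow_left₀ (by linarith) (by linarith) 2
    nlinarith
  · rcases le_total c √ζ with h2 | h2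
    · nlinarith [sq_nonneg w]
    · nlinarith [sq_nonneg w]

end PhaseOnly

open PhaseOnly in
theorem theorem2 {n : ℕ} (f : Seminorm ℝ (PhaseOnly.Vec n))
    (hf : ∀ u : PhaseOnly.Vec n, f u = 0 → u = 0)
    (x : PhaseOnly.Vec n) (hx : ‖x‖ = 1) :
    -- all suprema, infima and expectations below are finite and not taken over empty sets
    ((PhaseOnly.constraintSet f x).Nonempty ∧
      Bornology.IsBounded (PhaseOnly.constraintSet f x) ∧
      MeasureTheory.Integrable (PhaseOnly.widthFun f x) (PhaseOnly.gaussianLaw n) ∧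
      (PhaseOnly.scaledSubdiff f x).Nonempty ∧
      Bornology.IsBounded (PhaseOnly.scaledSubdiff f x) ∧
      ∀ τ : ℝ, 0 ≤ τ → MeasureTheory.Integrable
        (fun g => Metric.infDist g (τ • PhaseOnly.scaledSubdiff f x) ^ 2)
        (PhaseOnly.gaussianLaw n)) ∧
    -- the upper bound
    PhaseOnly.zetaPO f x ≤ PhaseOnly.zetaHat f x ∧
    -- the lower bound
    PhaseOnly.zetaHat f x - √(8 * PhaseOnly.zetaHat f x / Real.pi)
        - √(2 * Real.pi) * PhaseOnly.rad (PhaseOnly.scaledSubdiff f x) / f x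
        - (1 - 2 / Real.pi) ≤ PhaseOnly.zetaPO f x := by
  have hfx : 0 < f x := by
    refine (apply_nonneg f x).lt_of_ne fun h => ?_
    rw [hf x h.symm, norm_zero] at hx
    exact zero_ne_one hx
  have hne : (scaledSubdiff f x).Nonempty := (nonempty_subdiff hfx).image _
  obtain ⟨K, hK⟩ := exists_lipschitzWith_widthFun (f := f) hx
  have hwi := hK.integrable_stdGaussian
  have hint : ∀ A : Set (Vec n), Integrable (fun g => Metric.infDist g A ^ 2) (gaussianLaw n) :=
    fun A => (Metric.lipschitz_infDist_pt A).memLp_two_stdGaussian.integrable_sq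
  refine ⟨⟨⟨_, neg_smul_mem_constraintSet hx⟩, ?_, hwi, hne, isCompact_scaledSubdiff.isBounded,
    fun τ _ => hint _⟩, le_ciInf fun τ => zetaPO_le_integral hfx hx τ.2, ?_⟩
  · exact (Metric.isBounded_closedBall (x := (0 : Vec n)) (r := ‖QInv x‖₊)).subset fun u hu =>
      mem_closedBall_zero_iff.mpr (norm_le_of_mem_constraintSet hx hu)
  set c := √(2 / Real.pi) with hc
  have hc2 : c ^ 2 = 2 / Real.pi := Real.sq_sqrt (by positivity)
  have hc0 : 0 < c := by positivity
  set S := scaledSubdiff f x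
  set D : Vec n → ℝ := fun g => Metric.infDist g (coneOver S)
  have hDl : LipschitzWith 1 D := Metric.lipschitz_infDist_pt _
  set m := ∫ g, D g ∂(gaussianLaw n)
  set d := ∫ g, D g ^ 2 ∂(gaussianLaw n)
  have hbdd : BddBelow (Set.range fun τ : ℝ≥0 =>
      ∫ g, Metric.infDist g ((τ : ℝ) • S) ^ 2 ∂(gaussianLaw n)) := by
    refine ⟨0, ?_⟩
    rintro _ ⟨τ, rfl⟩
    exact integral_nonneg fun g => sq_nonneg _
  have hvar : Var[D; gaussianLaw n] = d - m ^ 2 := variance_eq_sub hDl.memLp_two_stdGaussian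
  have hv1 := hDl.variance_stdGaussian_le
  have hv0 := variance_nonneg D (gaussianLaw n)
  rw [hvar] at hv0
  rw [show stdGaussian (Vec n) = gaussianLaw n from rfl, hvar] at hv1
  obtain ⟨τ, hτ, hτle⟩ := exists_integral_infDist_smul_sq_le hne isCompact_scaledSubdiff
    convex_scaledSubdiff (fun s hs => norm_le_rad hs) hx (mul_pos hc0 hfx)
    (fun s hs => inner_of_mem_scaledSubdiff hx hs)
  have hmw : m ≤ (∫ g, widthFun f x g ∂(gaussianLaw n)) + c := by
    have hi : Integrable (fun g : Vec n => |⟪x, g⟫|) (gaussianLaw n) :=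
      ((innerSL ℝ x).lipschitz.integrable_stdGaussian).abs
    rw [hc, ← integral_abs_inner_gaussianLaw hx, ← integral_add hwi hi]
    exact integral_mono hDl.integrable_stdGaussian (hwi.add hi)
      fun g => infDist_coneOver_le hfx hx g
  have hdζ : d ≤ zetaHat f x := by
    refine le_ciInf fun τ => integral_mono (hint _) (hint _) fun g => ?_
    exact pow_le_pow_left₀ Metric.infDist_nonneg (Metric.infDist_le_infDist_of_subset
      (smul_set_subset_coneOver S τ.2) hne.smul_set) 2
  have hζd : zetaHat f x ≤ d + 2 * rad S / (c * f x) :=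
    (ciInf_le hbdd ⟨τ, hτ⟩).trans hτle
  have hR : 0 ≤ rad S := (norm_nonneg _).trans (norm_le_rad hne.some_mem)
  have hfin := lower_bound_arith hc0.le
    (by rw [hc, Real.sqrt_le_one, div_le_one Real.pi_pos]; exact Real.two_le_pi)
    (integral_nonneg fun g => Metric.infDist_nonneg)
    (show 0 ≤ 2 * rad S / (c * f x) by positivity) hmw
    (show d ≤ m ^ 2 + 1 by rw [NNReal.coe_one] at hv1; linarith) (by linarith) hdζ hζd
  have e1 : √(8 * zetaHat f x / Real.pi) = 2 * c * √(zetaHat f x) := by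
    rw [show 8 * zetaHat f x / Real.pi = (2 * c) ^ 2 * zetaHat f x by rw [mul_pow, hc2]; ring,
      Real.sqrt_mul (by positivity), Real.sqrt_sq (by positivity)]
  have e2 : √(2 * Real.pi) * rad S / f x = 2 * rad S / (c * f x) := by
    have : √(2 * Real.pi) * c = 2 := by
      rw [hc, ← Real.sqrt_mul (by positivity),
        show 2 * Real.pi * (2 / Real.pi) = 2 * 2 by field_simp, Real.sqrt_mul_self zero_le_two]
    rw [div_eq_div_iff hfx.ne' (by positivity)]
    linear_combination (rad S * f x) * this
  rw [e1, e2, ← hc2]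
  exact hfin
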